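/- Let $(x_i^n,\ 1\le i\le n)_{n\ge 1}$ be a deterministic triangular array of positive real numbers, with empirical c.d.f.s $E_n(t)=\frac1n\#\{i\le n : x_i^n\le t\}$. Suppose that $\sup_{t\in\mathbb R}|E_n(t)-F(t)|\to 0$ as $n\to\infty$, where $F$ is (the c.d.f. of) a probability distribution on $(0,\infty)$. Let $\phi(y)=\int e^{-xy}\,F(dx)$, $y\ge 0$, be the Laplace transform of $F$, with inverse $\phi^{-1}:(0,1]\to[0,\infty)$, and for $u\in(0,1]$ let $$F_u(dx)=u^{-1}e^{-x\phi^{-1}(u)}\,F(dx).$$ On a probability space, for each $n\ge1$ let $(x^n_{\sigma_n(1)},\dots,x^n_{\sigma_n(n)})$ be a size-biased permutation of $(x_1^n,\dots,x_n^n)$, i.e. $\sigma_n$ is a random permutation of $\{1,\dots,n\}$ with $$\mathbb P\bigl(\sigma_n(k)=i_k \,\big|\, \sigma_n(1)=i_1,\dots,\sigma_n(k-1)=i_{k-1}\bigr)=\frac{x^n_{i_k}}{\sum_{i=1}^n x^n_i-\sum_{j<k}x^n_{i_j}}$$ for $1\le k\le n$ and all distinct $i_1,\dots,i_k$; the joint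 law of the $\sigma_n$ for different $n$ is arbitrary. For $u\in(0,1]$ with $\lfloor nu\rfloor\ge 1$ let $E_{n,u}$ be the empirical distribution of the last $\lfloor nu\rfloor$ terms of $(x^n_{\sigma_n(1)},\dots,x^n_{\sigma_n(n)})$. Then for each $\delta\in(0,1)$, almost surely, $$\sup_{u\in[\delta,1]}\ \sup_{I}\ |E_{n,u}(I)-F_u(I)|\longrightarrow 0\qquad (n\to\infty),$$ where $I$ ranges over all subintervals of $(0,\infty)$. -/

import Mathlib

open MeasureTheory ProbabilityTheory Filter Topology

namespace SizeBiased

noncomputable section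

/-- A random permutation `σ` of the indices `0, …, n-1` is size-biased for the positive sizes
`x 0, …, x (n-1)`: the index picked at step `k` is `σ k`, and given that the earlier picks are the
distinct indices `π j`, `j < k`, the remaining index `π k` is picked with probability
`x (π k) / (t - ∑_{j < k} x (π j))`, where `t` is the sum of all sizes. (Any tuple of distinct
indices is the beginning of some permutation `π`; for `k = 0` the condition on the earlier picks
is empty and the probability is `x (π 0) / t`.) -/
structure IsSizeBiasedPerm {Ω : Type*} [MeasurableSpace Ω] (P : Measure Ω) {n : ℕ}
    (x : Fin n → ℝ) (σ : Ω → Equiv.Perm (Fin n)) : Prop where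
  measurable : ∀ π : Equiv.Perm (Fin n), MeasurableSet {ω | σ ω = π}
  law : ∀ (π : Equiv.Perm (Fin n)) (k : Fin n),
    P[{ω | σ ω k = π k} | {ω | ∀ j < k, σ ω j = π j}] =
      ENNReal.ofReal (x (π k) / ((∑ i, x i) - ∑ j ∈ Finset.univ.filter (· < k), x (π j)))

/-- The empirical distribution of the numbers `y i`, `i ∈ s`, evaluated at the set `A`:
the proportion of the indices `i ∈ s` with `y i ∈ A`. -/
def empirical {ι : Type*} (s : Finset ι) (y : ι → ℝ) (A : Set ℝ) : ℝ :=
  (∑ i ∈ s, A.indicator (fun _ => (1 : ℝ)) (y i)) / (s.card : ℝ)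

/-- The last `m` positions among `0, …, n-1` (all of them when `n ≤ m`). -/
def lastPositions (n m : ℕ) : Finset (Fin n) :=
  Finset.univ.filter fun j => n ≤ (j : ℕ) + m

/-- The Laplace transform `φ y = ∫ e^{-xy} F(dx)`. -/
def laplace (F : Measure ℝ) (y : ℝ) : ℝ :=
  ∫ x, Real.exp (-(x * y)) ∂F

/-- The inverse of the Laplace transform `φ : [0, ∞) → (0, 1]`, used for `u ∈ (0, 1]`. -/
def laplaceInv (F : Measure ℝ) (u : ℝ) : ℝ :=
  Function.invFunOn (laplace F) (Set.Ici 0) u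

/-- The measure `F_u(dx) = u⁻¹ e^{-x φ⁻¹(u)} F(dx)`. -/
def tilted (F : Measure ℝ) (u : ℝ) : Measure ℝ :=
  F.withDensity fun x => ENNReal.ofReal (u⁻¹ * Real.exp (-(x * laplaceInv F u)))

end

end SizeBiased

/-! Give index `i` an independent exponential time `ξ i` of rate `x i`. By lack of memory, listing
the indices in increasing order of time gives a size-biased permutation
(`pi_expMeasure_strictMono_gt`, `IsSizeBiasedPerm.measure_le`). At time `s` about `∑ exp (-(x i *
s)) ≈ n φ(s)` indices survive, so at `s = φ⁻¹(m/n)` the survivors are nearly the last `m` terms. The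
proportion of all `n` indices that survive with size in `I` is about `∫_I e^{-xs} F(dx)`; dividing
by `m/n` gives the tilted measure. Hoeffding's inequality controls the survivor counts. Only `n`
times and `n²` index sets matter (`measureReal_exists_le_abs_deviation`), so a union bound costs a
factor `n³`. On the good event the estimate is deterministic (`abs_empirical_sub_tilted_le`), and
Borel–Cantelli concludes. -/

namespace SizeBiased

open scoped ENNReal

/-! ### Size-biased permutations as the order of exponential times. -/

/-- The sum of the sizes `y j`, `j ≥ k`. -/
noncomputable def tailSum {n : ℕ} (y : Fin n → ℝ) (k : Fin n) : ℝ :=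
  ∑ j, if k ≤ j then y j else 0

lemma tailSum_succ {n : ℕ} (y : Fin (n + 1) → ℝ) (k : Fin n) :
    tailSum y k.succ = tailSum (fun j => y j.succ) k := by
  simp [tailSum, Fin.sum_univ_succ]

lemma tailSum_zero {n : ℕ} (y : Fin (n + 1) → ℝ) : tailSum y 0 = ∑ j, y j := by
  simp [tailSum]

lemma sum_sub_sum_filter_lt {n : ℕ} (y : Fin n → ℝ) (k : Fin n) :
    (∑ i, y i) - ∑ j ∈ Finset.univ.filter (· < k), y j = tailSum y k := by
  rw [tailSum, ← Finset.sum_filter,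
    ← Finset.sum_filter_add_sum_filter_not Finset.univ (· < k) y]
  simp

lemma tailSum_pos {n : ℕ} {y : Fin n → ℝ} (hy : ∀ i, 0 < y i) (k : Fin n) :
    0 < tailSum y k := by
  refine Finset.sum_pos' (fun i _ => ?_) ⟨k, Finset.mem_univ _, ?_⟩
  · split_ifs
    exacts [(hy i).le, le_rfl]
  · simpa using hy k

/-- The probability that a size-biased permutation of the sizes `y` is the identity. -/
noncomputable def orderProb {n : ℕ} (y : Fin n → ℝ) : ℝ := ∏ k, y k / tailSum y k

lemma orderProb_nonneg {n : ℕ} {y : Fin n → ℝ} (hy : ∀ i, 0 < y i) : 0 ≤ orderProb y :=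
  Finset.prod_nonneg fun k _ => div_nonneg (hy k).le (tailSum_pos hy k).le

lemma expMeasure_Ioi {r : ℝ} (hr : 0 < r) {t : ℝ} (ht : 0 ≤ t) :
    expMeasure r (Set.Ioi t) = ENNReal.ofReal (Real.exp (-(r * t))) := by
  have := isProbabilityMeasure_expMeasure hr
  have h := cdf_expMeasure_eq hr t
  rw [if_pos ht, cdf_eq_real] at h
  have h2 := probReal_compl_eq_one_sub (μ := expMeasure r) (measurableSet_Iic (a := t))
  rw [Set.compl_Iic, h] at h2
  rw [← ENNReal.ofReal_toReal (measure_ne_top (expMeasure r) (Set.Ioi t))]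
  congr 1
  change (expMeasure r).real (Set.Ioi t) = _
  rw [h2]; ring

lemma measurable_exponentialPDF (r : ℝ) : Measurable (exponentialPDF r) :=
  (measurable_exponentialPDFReal r).ennreal_ofReal

/-- The factor `r / (r + S)` is the chance that a clock of rate `r` rings before one of rate `S`; it
becomes a factor of `orderProb`. -/
lemma exponentialPDF_mul_exp {r S : ℝ} (hr : 0 < r) (hS : 0 ≤ S) (s : ℝ) :
    exponentialPDF r s * ENNReal.ofReal (Real.exp (-(S * s))) =
      ENNReal.ofReal (r / (r + S)) * exponentialPDF (r + S) s := by
  rcases lt_or_ge s 0 with hs | hs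
  · simp [exponentialPDF_of_neg hs]
  · rw [exponentialPDF_of_nonneg hs, exponentialPDF_of_nonneg hs,
      ← ENNReal.ofReal_mul (by positivity), ← ENNReal.ofReal_mul (by positivity)]
    congr 1
    rw [show -((r + S) * s) = -(r * s) + -(S * s) by ring, Real.exp_add]
    field_simp

lemma setLIntegral_exp_expMeasure {r S t : ℝ} (hr : 0 < r) (hS : 0 ≤ S) (ht : 0 ≤ t) :
    ∫⁻ s in Set.Ioi t, ENNReal.ofReal (Real.exp (-(S * s))) ∂expMeasure r =
      ENNReal.ofReal (r / (r + S) * Real.exp (-((r + S) * t))) := by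
  have key : ∀ r, expMeasure r = volume.withDensity (exponentialPDF r) := fun r => rfl
  rw [key, setLIntegral_withDensity_eq_setLIntegral_mul _ (measurable_exponentialPDF r)
    (by fun_prop) measurableSet_Ioi]
  simp only [Pi.mul_apply, exponentialPDF_mul_exp hr hS]
  rw [lintegral_const_mul _ (measurable_exponentialPDF _),
    ← withDensity_apply _ measurableSet_Ioi, ← key, expMeasure_Ioi (by positivity) ht,
    ← ENNReal.ofReal_mul (by positivity)]

lemma measurableSet_strictMono_gt (n : ℕ) (t : ℝ) :
    MeasurableSet {ξ : Fin n → ℝ | StrictMono ξ ∧ ∀ i, t < ξ i} := by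
  have : {ξ : Fin n → ℝ | StrictMono ξ ∧ ∀ i, t < ξ i} =
      (⋂ i, ⋂ j, ⋂ _ : i < j, {ξ : Fin n → ℝ | ξ i < ξ j}) ∩ ⋂ i, {ξ | t < ξ i} := by
    ext ξ
    simp [StrictMono]
  rw [this]
  refine .inter (.iInter fun i => .iInter fun j => .iInter fun _ => ?_) (.iInter fun i => ?_)
  · exact measurableSet_lt (measurable_pi_apply i) (measurable_pi_apply j)
  · exact measurableSet_lt measurable_const (measurable_pi_apply i)

lemma strictMono_cons_gt {n : ℕ} (t s : ℝ) (ξ : Fin n → ℝ) :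
    (StrictMono (Fin.cons s ξ : Fin (n + 1) → ℝ) ∧
      ∀ i, t < (Fin.cons s ξ : Fin (n + 1) → ℝ) i) ↔
      t < s ∧ StrictMono ξ ∧ ∀ i, s < ξ i := by
  constructor
  · rintro ⟨h1, h2⟩
    refine ⟨by simpa using h2 0, fun i j hij => ?_, fun i => ?_⟩
    · simpa using h1 (Fin.succ_lt_succ_iff.2 hij)
    · simpa using h1 (Fin.succ_pos i)
  · rintro ⟨h1, h2, h3⟩
    refine ⟨fun i j hij => ?_, fun i => ?_⟩
    · induction j using Fin.cases with
      | zero => exact absurd hij (Fin.not_lt_zero i)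
      | succ j =>
        induction i using Fin.cases with
        | zero => simpa using h3 j
        | succ i => simpa using h2 (Fin.succ_lt_succ_iff.1 hij)
    · induction i using Fin.cases with
      | zero => simpa using h1
      | succ i => simpa using h1.trans (h3 i)

/-- The free lower bound `t` makes the induction close: once the first time is `s`, the others must
be sorted and exceed `s`. Only `t = 0` is needed later. -/
lemma pi_expMeasure_strictMono_gt {n : ℕ} (y : Fin n → ℝ) (hy : ∀ i, 0 < y i) {t : ℝ}
    (ht : 0 ≤ t) :
    Measure.pi (fun i => expMeasure (y i)) {ξ | StrictMono ξ ∧ ∀ i, t < ξ i} =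
      ENNReal.ofReal (orderProb y * Real.exp (-((∑ i, y i) * t))) := by
  induction n generalizing t with
  | zero =>
    have : {ξ : Fin 0 → ℝ | StrictMono ξ ∧ ∀ i, t < ξ i} = Set.univ := by
      ext ξ
      simp [Subsingleton.strictMono]
    rw [this]
    simp [orderProb]
  | succ n ih =>
    have hp : ∀ i, IsProbabilityMeasure (expMeasure (y i)) := fun i =>
      isProbabilityMeasure_expMeasure (hy i)
    have mp := (measurePreserving_piFinSuccAbove (fun i => expMeasure (y i)) 0).symm
    have hpre : (MeasurableEquiv.piFinSuccAbove (fun _ : Fin (n + 1) => ℝ) 0).symm ⁻¹'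
        {ξ | StrictMono ξ ∧ ∀ i, t < ξ i} =
        {p : ℝ × (Fin n → ℝ) | t < p.1 ∧ StrictMono p.2 ∧ ∀ i, p.1 < p.2 i} := by
      ext ⟨s, ξ⟩
      rw [Set.mem_preimage]
      have : (MeasurableEquiv.piFinSuccAbove (fun _ : Fin (n + 1) => ℝ) 0).symm (s, ξ) =
          Fin.cons s ξ := by
        simp [MeasurableEquiv.piFinSuccAbove_symm_apply, Fin.insertNthEquiv]
      rw [this]
      exact strictMono_cons_gt t s ξ
    rw [← mp.measure_preimage (measurableSet_strictMono_gt _ _).nullMeasurableSet, hpre,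
      Measure.prod_apply (by
        rw [← hpre]; exact mp.measurable (measurableSet_strictMono_gt _ _))]
    have hS : 0 ≤ ∑ i : Fin n, y i.succ := Finset.sum_nonneg fun i _ => (hy _).le
    have h1 : ∀ s, Measure.pi (fun j : Fin n => expMeasure (y (Fin.succAbove 0 j)))
        (Prod.mk s ⁻¹' {p : ℝ × (Fin n → ℝ) | t < p.1 ∧ StrictMono p.2 ∧ ∀ i, p.1 < p.2 i}) =
        (Set.Ioi t).indicator (fun s => ENNReal.ofReal (orderProb fun j : Fin n => y j.succ) *
          ENNReal.ofReal (Real.exp (-((∑ i : Fin n, y i.succ) * s)))) s := by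
      intro s
      by_cases hs : t < s
      · rw [Set.indicator_of_mem (Set.mem_Ioi.2 hs),
          ← ENNReal.ofReal_mul (orderProb_nonneg fun i => hy _),
          ← ih (fun j => y j.succ) (fun j => hy _) (ht.trans hs.le)]
        simp [hs]
      · rw [Set.indicator_of_notMem (by simpa using hs)]
        simp [hs]
    simp only [h1]
    rw [lintegral_indicator measurableSet_Ioi, lintegral_const_mul _ (by fun_prop),
      setLIntegral_exp_expMeasure (hy 0) hS ht,
      ← ENNReal.ofReal_mul (orderProb_nonneg fun i => hy _)]
    congr 1
    rw [orderProb, orderProb, Fin.prod_univ_succ, tailSum_zero, Fin.sum_univ_succ]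
    simp only [tailSum_succ]
    ring

/-- An inequality suffices, since only upper bounds are carried over from exponential times to
permutations; it arises by dropping the condition that the times are positive. -/
lemma pi_expMeasure_strictMono_comp {n : ℕ} (x : Fin n → ℝ) (hx : ∀ i, 0 < x i)
    (π : Equiv.Perm (Fin n)) :
    ENNReal.ofReal (orderProb (x ∘ π)) ≤
      Measure.pi (fun i => expMeasure (x i)) {ξ | StrictMono (ξ ∘ π)} := by
  have hp : ∀ i, IsProbabilityMeasure (expMeasure (x i)) := fun i =>
    isProbabilityMeasure_expMeasure (hx i)
  have mp := measurePreserving_piCongrLeft (fun i => expMeasure (x i)) π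
  have h := pi_expMeasure_strictMono_gt (x ∘ π) (fun i => hx _) le_rfl
  simp only [mul_zero, neg_zero, Real.exp_zero, mul_one] at h
  rw [← h, ← mp.measure_preimage_equiv]
  refine measure_mono fun ξ hξ => ?_
  simp only [Set.mem_preimage, Set.mem_ofPred_eq]
  convert hξ.1 using 1
  ext i
  simp [MeasurableEquiv.coe_piCongrLeft, Equiv.piCongrLeft_apply_apply]

lemma IsSizeBiasedPerm.measure_eq {Ω : Type*} [MeasurableSpace Ω] {P : Measure Ω}
    [IsProbabilityMeasure P] {n : ℕ} {x : Fin n → ℝ} (hx : ∀ i, 0 < x i)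
    {σ : Ω → Equiv.Perm (Fin n)} (h : IsSizeBiasedPerm P x σ) (π : Equiv.Perm (Fin n)) :
    P {ω | σ ω = π} = ENNReal.ofReal (orderProb (x ∘ π)) := by
  have hm : ∀ B : Set (Equiv.Perm (Fin n)), MeasurableSet {ω | σ ω ∈ B} := by
    intro B
    have : {ω | σ ω ∈ B} = ⋃ π ∈ B, {ω | σ ω = π} := by ext ω; simp
    rw [this]
    exact (Set.toFinite B).measurableSet_biUnion fun π _ => h.measurable π
  have key : ∀ m ≤ n, P {ω | ∀ j : Fin n, (j : ℕ) < m → σ ω j = π j} =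
      ∏ k : Fin n, if (k : ℕ) < m then ENNReal.ofReal (x (π k) / tailSum (x ∘ π) k) else 1 := by
    intro m
    induction m with
    | zero => simp
    | succ m ih =>
      intro hmn
      have hlaw := h.law π ⟨m, hmn⟩
      have h2 : (∑ i, x i) = ∑ i, (x ∘ π) i := (Equiv.sum_comp π x).symm
      have h3 := sum_sub_sum_filter_lt (x ∘ π) ⟨m, hmn⟩
      rw [← h2] at h3
      simp only [Function.comp_apply] at h3
      rw [h3] at hlaw
      have hms := hm {ρ | ∀ j < (⟨m, hmn⟩ : Fin n), ρ j = π j}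
      have hc := cond_mul_eq_inter hms {ω | σ ω ⟨m, hmn⟩ = π ⟨m, hmn⟩} P
      simp only [Set.mem_ofPred_eq] at hc
      rw [hlaw] at hc
      have e1 : {ω | ∀ j < (⟨m, hmn⟩ : Fin n), σ ω j = π j} ∩ {ω | σ ω ⟨m, hmn⟩ = π ⟨m, hmn⟩} =
          {ω | ∀ j : Fin n, (j : ℕ) < m + 1 → σ ω j = π j} := by
        ext ω
        simp only [Set.mem_inter_iff, Set.mem_ofPred_eq]
        constructor
        · rintro ⟨ha, hb⟩ j hj
          rcases Nat.lt_succ_iff_lt_or_eq.1 hj with hj | hj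
          · exact ha j (Fin.lt_def.2 hj)
          · have : j = ⟨m, hmn⟩ := Fin.ext hj
            rw [this]; exact hb
        · exact fun ha => ⟨fun j hj => ha j (Nat.lt_succ_of_lt (Fin.lt_def.1 hj)),
            ha _ (Nat.lt_succ_self m)⟩
      have e2 : {ω | ∀ j < (⟨m, hmn⟩ : Fin n), σ ω j = π j} =
          {ω | ∀ j : Fin n, (j : ℕ) < m → σ ω j = π j} := by
        ext ω; simp [Fin.lt_def]
      rw [e1, e2, ih (by omega)] at hc
      rw [← hc]
      rw [← Finset.mul_prod_erase Finset.univ _ (Finset.mem_univ (⟨m, hmn⟩ : Fin n)),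
        ← Finset.mul_prod_erase Finset.univ (fun k : Fin n => if (k : ℕ) < m + 1 then _ else _)
          (Finset.mem_univ (⟨m, hmn⟩ : Fin n))]
      simp only [lt_irrefl, if_false, one_mul, Nat.lt_succ_self, if_true]
      congr 1
      refine Finset.prod_congr rfl fun k hk => ?_
      have : (k : ℕ) ≠ m := fun hk' => Finset.ne_of_mem_erase hk (Fin.ext hk')
      have h4 : ((k : ℕ) < m) ↔ ((k : ℕ) < m + 1) := by omega
      simp only [h4]
  have hn := key n le_rfl
  have e3 : {ω | ∀ j : Fin n, (j : ℕ) < n → σ ω j = π j} = {ω | σ ω = π} := by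
    ext ω
    simp [Equiv.ext_iff]
  rw [e3] at hn
  have h0 : ∀ k ∈ Finset.univ, 0 ≤ (x ∘ π) k / tailSum (x ∘ π) k := fun k _ =>
    div_nonneg (hx (π k)).le (tailSum_pos (fun i => hx (π i)) k).le
  rw [hn, orderProb, ENNReal.ofReal_prod_of_nonneg h0]
  simp

/-- An upper bound for the probability of an event about a size-biased permutation, from the
representation of such a permutation by the order of independent exponential times. -/
lemma IsSizeBiasedPerm.measure_le {Ω : Type*} [MeasurableSpace Ω] {P : Measure Ω}
    [IsProbabilityMeasure P] {n : ℕ} {x : Fin n → ℝ} (hx : ∀ i, 0 < x i)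
    {σ : Ω → Equiv.Perm (Fin n)} (h : IsSizeBiasedPerm P x σ) (B : Set (Equiv.Perm (Fin n)))
    (S : Set (Fin n → ℝ)) (hBS : ∀ π ∈ B, ∀ ξ : Fin n → ℝ, StrictMono (ξ ∘ π) → ξ ∈ S) :
    P {ω | σ ω ∈ B} ≤ Measure.pi (fun i => expMeasure (x i)) S := by
  classical
  have e : {ω | σ ω ∈ B} = ⋃ π ∈ B.toFinset, {ω | σ ω = π} := by ext ω; simp
  have hms : ∀ π : Equiv.Perm (Fin n), MeasurableSet {ξ : Fin n → ℝ | StrictMono (ξ ∘ π)} := by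
    intro π
    have : {ξ : Fin n → ℝ | StrictMono (ξ ∘ π)} =
        ⋂ i, ⋂ j, ⋂ _ : i < j, {ξ : Fin n → ℝ | ξ (π i) < ξ (π j)} := by
      ext ξ
      simp [StrictMono]
    rw [this]
    exact .iInter fun i => .iInter fun j => .iInter fun _ =>
      measurableSet_lt (measurable_pi_apply _) (measurable_pi_apply _)
  calc P {ω | σ ω ∈ B} ≤ ∑ π ∈ B.toFinset, P {ω | σ ω = π} := by
        rw [e]; exact measure_biUnion_finset_le _ _
    _ ≤ ∑ π ∈ B.toFinset, Measure.pi (fun i => expMeasure (x i)) {ξ | StrictMono (ξ ∘ π)} :=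
        Finset.sum_le_sum fun π _ => by
          rw [h.measure_eq hx]; exact pi_expMeasure_strictMono_comp x hx π
    _ = Measure.pi (fun i => expMeasure (x i)) (⋃ π ∈ B.toFinset, {ξ | StrictMono (ξ ∘ π)}) := by
        refine (measure_biUnion_finset (fun π _ ρ _ hπρ => ?_) fun π _ => hms π).symm
        refine Set.disjoint_left.2 fun ξ h1 h2 => hπρ ?_
        -- If `π` and `ρ` both sort `ξ`, then `ρ⁻¹π` is an order automorphism of `Fin n`, hence the
        -- identity.
        have h3 : StrictMono (ρ.symm ∘ π : Fin n → Fin n) := by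
          intro i j hij
          have h4 := h1 hij
          rw [← (show StrictMono (ξ ∘ ρ) from h2).lt_iff_lt]
          simpa using h4
        have h5 : (ρ.symm ∘ π : Fin n → Fin n) = id := by
          have := Subsingleton.elim (StrictMono.orderIsoOfSurjective _ h3
            ((ρ.symm.surjective).comp π.surjective)) (OrderIso.refl (Fin n))
          ext1 i
          exact congrArg (fun f : Fin n ≃o Fin n => f i) this
        ext1 i
        exact ρ.symm_apply_eq.1 (congrFun h5 i)
    _ ≤ _ := measure_mono (Set.iUnion₂_subset fun π hπ ξ hξ =>
        hBS π (by simpa using hπ) ξ hξ)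

/-! ### From distribution functions to intervals and Laplace transforms. -/

lemma isLowerSet_real_cases {L : Set ℝ} (hL : IsLowerSet L) :
    L = ∅ ∨ L = Set.univ ∨ ∃ a, L = Set.Iic a ∨ L = Set.Iio a := by
  rcases L.eq_empty_or_nonempty with h | hne
  · exact .inl h
  right
  by_cases hb : BddAbove L
  · right
    refine ⟨sSup L, ?_⟩
    by_cases hm : sSup L ∈ L
    · exact .inl (Set.Subset.antisymm (fun x hx => le_csSup hb hx) fun x hx => hL hx hm)
    · refine .inr (Set.Subset.antisymm (fun x hx => lt_of_le_of_ne (le_csSup hb hx) ?_)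
        fun x hx => ?_)
      · rintro rfl; exact hm hx
      · obtain ⟨y, hy, hxy⟩ := exists_lt_of_lt_csSup hne hx
        exact hL hxy.le hy
  · left
    refine Set.eq_univ_of_forall fun x => ?_
    obtain ⟨y, hy, hxy⟩ := not_bddAbove_iff.1 hb x
    exact hL hxy.le hy

lemma tendsto_measureReal_Iic_left (μ : Measure ℝ) [IsFiniteMeasure μ] (a : ℝ) :
    Tendsto (fun k : ℕ => μ.real (Set.Iic (a - 1 / ((k : ℝ) + 1)))) atTop
      (𝓝 (μ.real (Set.Iio a))) := by
  have hu : ⋃ k : ℕ, Set.Iic (a - 1 / ((k : ℝ) + 1)) = Set.Iio a := by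
    ext x
    simp only [Set.mem_iUnion, Set.mem_Iic, Set.mem_Iio]
    constructor
    · rintro ⟨k, hk⟩
      have : 0 < 1 / ((k : ℝ) + 1) := by positivity
      linarith
    · intro hx
      obtain ⟨k, hk⟩ := exists_nat_one_div_lt (sub_pos.2 hx)
      exact ⟨k, by linarith⟩
  have hmono : Monotone fun k : ℕ => Set.Iic (a - 1 / ((k : ℝ) + 1)) := by
    intro k l hkl
    refine Set.Iic_subset_Iic.2 (sub_le_sub_left ?_ _)
    exact Nat.one_div_le_one_div hkl
  rw [← hu]
  exact (ENNReal.tendsto_toReal (measure_ne_top _ _)).comp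
    (tendsto_measure_iUnion_atTop hmono)

section

variable {μ ν : Measure ℝ} [IsProbabilityMeasure μ] [IsProbabilityMeasure ν] {D : ℝ}

lemma abs_measureReal_sub_le_of_isLowerSet
    (h : ∀ t, |μ.real (Set.Iic t) - ν.real (Set.Iic t)| ≤ D) {L : Set ℝ} (hL : IsLowerSet L) :
    |μ.real L - ν.real L| ≤ D := by
  have hD : 0 ≤ D := (abs_nonneg _).trans (h 0)
  rcases isLowerSet_real_cases hL with rfl | rfl | ⟨a, rfl | rfl⟩
  · simpa
  · simpa
  · exact h a
  · exact le_of_tendsto ((tendsto_measureReal_Iic_left μ a).sub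
      (tendsto_measureReal_Iic_left ν a)).abs (Eventually.of_forall fun k => h _)

/-- An interval is the difference of two lower sets, its lower closure `L` and `L \ J`; each
contributes an error `D`. -/
lemma abs_measureReal_sub_le_of_ordConnected
    (h : ∀ t, |μ.real (Set.Iic t) - ν.real (Set.Iic t)| ≤ D) {J : Set ℝ} (hJ : J.OrdConnected) :
    |μ.real J - ν.real J| ≤ 2 * D := by
  let L : Set ℝ := (lowerClosure J : LowerSet ℝ)
  have hL : IsLowerSet L := (lowerClosure J).lower
  have hJL : J ⊆ L := subset_lowerClosure
  have hM : IsLowerSet (L \ J) := by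
    rintro a b hba ⟨haL, haJ⟩
    refine ⟨hL hba haL, fun hbJ => haJ ?_⟩
    obtain ⟨c, hc, hac⟩ := haL
    exact hJ.out hbJ hc ⟨hba, hac⟩
  have hd : ∀ ρ : Measure ℝ, [IsProbabilityMeasure ρ] → ρ.real (L \ J) = ρ.real L - ρ.real J :=
    fun ρ _ => measureReal_sdiff hJL hJ.measurableSet
  have h1 := abs_measureReal_sub_le_of_isLowerSet h hL
  have h2 := abs_measureReal_sub_le_of_isLowerSet h hM
  rw [hd, hd] at h2
  rw [abs_le] at *
  constructor <;> linarith

lemma exp_indicator_mem_Icc {y : ℝ} (hy : 0 ≤ y) {I : Set ℝ} (hI : I ⊆ Set.Ioi 0) (x : ℝ) :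
    I.indicator (fun x => Real.exp (-(x * y))) x ∈ Set.Icc (0 : ℝ) 1 := by
  by_cases hx : x ∈ I
  · have : 0 ≤ x * y := mul_nonneg (Set.mem_Ioi.1 (hI hx)).le hy
    rw [Set.indicator_of_mem hx]
    exact ⟨(Real.exp_pos _).le, Real.exp_le_one_iff.2 (by linarith)⟩
  · simp [Set.indicator_of_notMem hx]

/-- Layer-cake formula. The level sets are again intervals and the levels fill only `(0, 1]`, so the
resulting error bound does not depend on `y`. -/
lemma setIntegral_exp_eq {ρ : Measure ℝ} [IsProbabilityMeasure ρ] {y : ℝ} (hy : 0 ≤ y)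
    {I : Set ℝ} (hI : I.OrdConnected) (hI0 : I ⊆ Set.Ioi 0) :
    ∫ x in I, Real.exp (-(x * y)) ∂ρ =
      ∫ s in Set.Ioc (0 : ℝ) 1, ρ.real (I ∩ {x | s < Real.exp (-(x * y))}) := by
  have hmem := exp_indicator_mem_Icc hy hI0
  have hi : Integrable (I.indicator fun x => Real.exp (-(x * y))) ρ :=
    .of_mem_Icc 0 1 ((Measurable.indicator (by fun_prop) hI.measurableSet).aemeasurable)
      (Eventually.of_forall hmem)
  rw [← integral_indicator hI.measurableSet,
    hi.integral_eq_integral_meas_lt (Eventually.of_forall fun x => (hmem x).1),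
    setIntegral_eq_of_subset_of_forall_sdiff_eq_zero measurableSet_Ioi
      (show Set.Ioc (0 : ℝ) 1 ⊆ Set.Ioi 0 from Set.Ioc_subset_Ioi_self)]
  · refine setIntegral_congr_fun measurableSet_Ioc fun s hs => ?_
    congr 1
    ext x
    by_cases hx : x ∈ I <;> simp [hx, hs.1.le]
  · intro s hs
    have : {x | s < I.indicator (fun x => Real.exp (-(x * y))) x} = ∅ := by
      refine Set.eq_empty_of_forall_notMem fun x hx => ?_
      have h1 : s < _ := hx
      have := (hmem x).2
      exact hs.2 ⟨hs.1, by linarith⟩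
    simp [this]

lemma ordConnected_inter_exp {y : ℝ} (hy : 0 ≤ y) {I : Set ℝ} (hI : I.OrdConnected) (s : ℝ) :
    (I ∩ {x | s < Real.exp (-(x * y))}).OrdConnected := by
  refine hI.inter (IsLowerSet.ordConnected fun a b hba ha => ?_)
  refine lt_of_lt_of_le (show s < Real.exp (-(a * y)) from ha) ?_
  exact Real.exp_le_exp.2 (neg_le_neg (mul_le_mul_of_nonneg_right hba hy))

lemma integrableOn_measureReal_exp (ρ : Measure ℝ) [IsProbabilityMeasure ρ] {y : ℝ}
    (I : Set ℝ) :
    IntegrableOn (fun s => ρ.real (I ∩ {x | s < Real.exp (-(x * y))})) (Set.Ioc (0 : ℝ) 1) := by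
  have ha : Antitone fun s => ρ.real (I ∩ {x | s < Real.exp (-(x * y))}) := fun s t hst =>
    measureReal_mono (Set.inter_subset_inter_right _ fun x hx => lt_of_le_of_lt hst hx)
  exact .of_mem_Icc 0 1 ha.measurable.aemeasurable
    (Eventually.of_forall fun s => ⟨measureReal_nonneg, measureReal_le_one⟩)

/-- If two distribution functions differ by at most `D`, then the Laplace transforms, restricted to
any interval, differ by at most `2 D`. -/
lemma abs_setIntegral_exp_sub_le
    (h : ∀ t, |μ.real (Set.Iic t) - ν.real (Set.Iic t)| ≤ D) {y : ℝ} (hy : 0 ≤ y)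
    {I : Set ℝ} (hI : I.OrdConnected) (hI0 : I ⊆ Set.Ioi 0) :
    |∫ x in I, Real.exp (-(x * y)) ∂μ - ∫ x in I, Real.exp (-(x * y)) ∂ν| ≤ 2 * D := by
  rw [setIntegral_exp_eq hy hI hI0, setIntegral_exp_eq hy hI hI0,
    ← integral_sub (integrableOn_measureReal_exp μ I) (integrableOn_measureReal_exp ν I),
    ← Real.norm_eq_abs]
  refine (norm_setIntegral_le_of_norm_le_const (C := 2 * D) (by simp) fun s _ => ?_).trans
    (by simp)
  exact abs_measureReal_sub_le_of_ordConnected h (ordConnected_inter_exp hy hI s)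

end

/-! ### Concentration of the survivor counts. -/

/-- The number of indices `i ∈ A` with `t < ξ i`, minus its expectation if the `ξ i` are
exponentially distributed with rates `x i`. -/
noncomputable def deviation {n : ℕ} (x : Fin n → ℝ) (A : Finset (Fin n)) (t : ℝ)
    (ξ : Fin n → ℝ) : ℝ :=
  ∑ i ∈ A, ((Set.Ioi t).indicator (fun _ => (1 : ℝ)) (ξ i) - Real.exp (-(x i * t)))

lemma integral_indicator_expMeasure {r : ℝ} (hr : 0 < r) {t : ℝ} (ht : 0 ≤ t) :
    ∫ s, (Set.Ioi t).indicator (fun _ => (1 : ℝ)) s ∂expMeasure r = Real.exp (-(r * t)) := by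
  rw [integral_indicator_const _ measurableSet_Ioi, Measure.real, expMeasure_Ioi hr ht,
    ENNReal.toReal_ofReal (Real.exp_pos _).le]
  simp

/-- Hoeffding: a variable in an interval of length 1 has variance proxy `1/4`, and `(nη)² / (2 ·
n/4) = 2nη²`. General endpoints let it serve both `f` and `-f`. -/
lemma measureReal_le_sum_sub_integral {n : ℕ} (ν : Fin n → Measure ℝ)
    [∀ i, IsProbabilityMeasure (ν i)] (f : Fin n → ℝ → ℝ) (hf : ∀ i, Measurable (f i))
    {a b : ℝ} (hb : ∀ i s, f i s ∈ Set.Icc a b) (hab : b = a + 1) {η : ℝ} (hη : 0 ≤ η) :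
    (Measure.pi ν).real {ξ | (n : ℝ) * η ≤ ∑ i, (f i (ξ i) - ∫ s, f i s ∂ν i)} ≤
      Real.exp (-(2 * n * η ^ 2)) := by
  have hind := iIndepFun_pi (μ := ν) (X := fun i s => f i s - ∫ s, f i s ∂ν i)
    fun i => ((hf i).sub_const _).aemeasurable
  have hsub : ∀ i ∈ (Finset.univ : Finset (Fin n)),
      HasSubgaussianMGF (fun ξ : Fin n → ℝ => f i (ξ i) - ∫ s, f i s ∂ν i)
        ((‖b - a‖₊ / 2) ^ 2) (Measure.pi ν) := by
    intro i _
    have h := hasSubgaussianMGF_of_mem_Icc (μ := Measure.pi ν) (X := fun ξ => f i (ξ i))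
      (a := a) (b := b) ((hf i).comp (measurable_pi_apply i)).aemeasurable
      (Eventually.of_forall fun ξ => hb i (ξ i))
    have hm : (∫ ξ, f i (ξ i) ∂Measure.pi ν) = ∫ s, f i s ∂ν i :=
      integral_comp_eval (μ := ν) (i := i) (hf i).aestronglyMeasurable
    rwa [hm] at h
  refine (HasSubgaussianMGF.measure_sum_ge_le_of_iIndepFun hind hsub
    (by positivity : 0 ≤ (n : ℝ) * η)).trans (Real.exp_le_exp.2 (le_of_eq ?_))
  rcases Nat.eq_zero_or_pos n with rfl | hn
  · simp
  · have : (0 : ℝ) < n := by exact_mod_cast hn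
    simp [hab]
    field_simp

lemma measureReal_le_abs_deviation {n : ℕ} {x : Fin n → ℝ} (hx : ∀ i, 0 < x i)
    (A : Finset (Fin n)) {t : ℝ} (ht : 0 ≤ t) {η : ℝ} (hη : 0 ≤ η) :
    (Measure.pi fun i => expMeasure (x i)).real {ξ | (n : ℝ) * η ≤ |deviation x A t ξ|} ≤
      2 * Real.exp (-(2 * n * η ^ 2)) := by
  classical
  have hp : ∀ i, IsProbabilityMeasure (expMeasure (x i)) := fun i =>
    isProbabilityMeasure_expMeasure (hx i)
  -- Zero terms outside `A` keep `n` summands, so the bound is the same for all `A`.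
  let f : Fin n → ℝ → ℝ := fun i s => if i ∈ A then (Set.Ioi t).indicator (fun _ => 1) s else 0
  have hf : ∀ i, Measurable (f i) := fun i => by
    by_cases hi : i ∈ A
    · simpa [f, hi] using measurable_const.indicator measurableSet_Ioi
    · simp [f, hi]
  have hb : ∀ i s, f i s ∈ Set.Icc (0 : ℝ) 1 := fun i s => by
    by_cases hi : i ∈ A <;> by_cases hs : t < s <;> simp [f, hi, hs]
  have hint : ∀ i, ∫ s, f i s ∂expMeasure (x i) =
      if i ∈ A then Real.exp (-(x i * t)) else 0 := fun i => by
    by_cases hi : i ∈ A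
    · simpa [f, hi] using integral_indicator_expMeasure (hx i) ht
    · simp [f, hi]
  have hdev : ∀ ξ, deviation x A t ξ = ∑ i, (f i (ξ i) - ∫ s, f i s ∂expMeasure (x i)) := by
    intro ξ
    simp only [hint, deviation]
    rw [← Finset.sum_filter_add_sum_filter_not Finset.univ (· ∈ A) fun i =>
      f i (ξ i) - if i ∈ A then Real.exp (-(x i * t)) else 0]
    rw [Finset.sum_eq_zero (s := Finset.univ.filter (· ∉ A)) fun i hi => by
      simp [f, (Finset.mem_filter.1 hi).2]]
    simp only [Finset.filter_univ_mem, add_zero]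
    exact Finset.sum_congr rfl fun i hi => by simp [f, hi]
  have h1 := measureReal_le_sum_sub_integral (fun i => expMeasure (x i)) f hf hb (by simp) hη
  have h2 := measureReal_le_sum_sub_integral (fun i => expMeasure (x i)) (fun i s => -f i s)
    (fun i => (hf i).neg) (a := -1) (b := 0)
    (fun i s => ⟨neg_le_neg (hb i s).2, neg_nonpos.2 (hb i s).1⟩) (by simp) hη
  have h3 : {ξ | (n : ℝ) * η ≤ |deviation x A t ξ|} ⊆
      {ξ | (n : ℝ) * η ≤ ∑ i, (f i (ξ i) - ∫ s, f i s ∂expMeasure (x i))} ∪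
      {ξ | (n : ℝ) * η ≤ ∑ i, (-f i (ξ i) - ∫ s, -f i s ∂expMeasure (x i))} := by
    intro ξ hξ
    rcases le_abs.1 (show (n : ℝ) * η ≤ |deviation x A t ξ| from hξ) with h | h
    · left; rwa [hdev] at h
    · right
      rw [hdev, ← Finset.sum_neg_distrib] at h
      refine h.trans (le_of_eq (Finset.sum_congr rfl fun i _ => ?_))
      rw [integral_neg]; ring
  calc _ ≤ _ := measureReal_mono h3
    _ ≤ _ := measureReal_union_le _ _
    _ ≤ _ := by linarith

/-- The index sets `{i | x i ∈ I}` for intervals `I` are of the form `{i | x j ≤ x i ≤ x k}`. -/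
lemma filter_mem_ordConnected_eq {n : ℕ} (x : Fin n → ℝ) {I : Set ℝ} (hI : I.OrdConnected)
    [DecidablePred fun i => x i ∈ I] :
    (Finset.univ.filter fun i => x i ∈ I) = ∅ ∨ ∃ j k, (Finset.univ.filter fun i => x i ∈ I) =
      Finset.univ.filter fun i => x j ≤ x i ∧ x i ≤ x k := by
  rcases (Finset.univ.filter fun i => x i ∈ I).eq_empty_or_nonempty with h | h
  · exact .inl h
  · right
    obtain ⟨j, hj, hj'⟩ := Finset.exists_min_image _ x h
    obtain ⟨k, hk, hk'⟩ := Finset.exists_max_image _ x h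
    refine ⟨j, k, Finset.ext fun i => ⟨fun hi => ?_, fun hi => ?_⟩⟩
    · simpa using ⟨hj' i hi, hk' i hi⟩
    · simp only [Finset.mem_filter, Finset.mem_univ, true_and] at hi hj hk ⊢
      exact hI.out hj hk hi

open Classical in
-- Union bound over `n` times and `n²` pairs of extreme indices `(j, k)`.
lemma measureReal_exists_le_abs_deviation {n : ℕ} {x : Fin n → ℝ} (hx : ∀ i, 0 < x i)
    {t : ℕ → ℝ} (ht : ∀ m ∈ Finset.Icc 1 n, 0 ≤ t m) {η : ℝ} (hη : 0 < η) :
    (Measure.pi fun i => expMeasure (x i)).real {ξ | ∃ m ∈ Finset.Icc 1 n, ∃ I : Set ℝ,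
      I.OrdConnected ∧ (n : ℝ) * η ≤ |deviation x (Finset.univ.filter (x · ∈ I)) (t m) ξ|} ≤
      2 * n ^ 3 * Real.exp (-(2 * n * η ^ 2)) := by
  have hp : ∀ i, IsProbabilityMeasure (expMeasure (x i)) := fun i =>
    isProbabilityMeasure_expMeasure (hx i)
  let A : Fin n × Fin n → Finset (Fin n) := fun p =>
    Finset.univ.filter fun i => x p.1 ≤ x i ∧ x i ≤ x p.2
  have hsub : {ξ | ∃ m ∈ Finset.Icc 1 n, ∃ I : Set ℝ, I.OrdConnected ∧
      (n : ℝ) * η ≤ |deviation x (Finset.univ.filter (x · ∈ I)) (t m) ξ|} ⊆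
      ⋃ q ∈ Finset.Icc 1 n ×ˢ (Finset.univ : Finset (Fin n × Fin n)),
        {ξ | (n : ℝ) * η ≤ |deviation x (A q.2) (t q.1) ξ|} := by
    rintro ξ ⟨m, hm, I, hI, h⟩
    have hn : (0 : ℝ) < n := by
      have := Finset.mem_Icc.1 hm
      exact_mod_cast (by omega : 0 < n)
    -- An empty index set has deviation `0 < nη` and needs no event of its own.
    rcases filter_mem_ordConnected_eq x hI with h0 | ⟨j, k, hjk⟩
    · rw [h0] at h
      simp only [deviation, Finset.sum_empty, abs_zero] at h
      exact absurd h (not_le.2 (by positivity))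
    · rw [hjk] at h
      simp only [Set.mem_iUnion]
      exact ⟨(m, j, k), Finset.mem_product.2 ⟨hm, Finset.mem_univ _⟩, h⟩
  calc _ ≤ _ := measureReal_mono hsub (measure_ne_top _ _)
    _ ≤ _ := measureReal_biUnion_finset_le _ _
    _ ≤ ∑ q ∈ Finset.Icc 1 n ×ˢ (Finset.univ : Finset (Fin n × Fin n)),
        2 * Real.exp (-(2 * n * η ^ 2)) :=
      Finset.sum_le_sum fun q hq => measureReal_le_abs_deviation hx _ (ht _ (Finset.mem_product.1 hq).1) hη.le
    _ = _ := by
      simp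
      ring

/-! ### Laplace transform, tilted measures and the empirical measure. -/

section

variable {F : Measure ℝ} [IsProbabilityMeasure F]

lemma ae_pos (hF : F (Set.Ioi 0) = 1) : ∀ᵐ x ∂F, 0 < x :=
  (prob_compl_eq_zero_iff measurableSet_Ioi).2 hF

lemma ae_norm_exp_le (hF : F (Set.Ioi 0) = 1) {y : ℝ} (hy : 0 ≤ y) :
    ∀ᵐ x ∂F, ‖Real.exp (-(x * y))‖ ≤ 1 := by
  filter_upwards [ae_pos hF] with x hx
  rw [Real.norm_eq_abs, Real.abs_exp, Real.exp_le_one_iff, neg_nonpos]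
  positivity

lemma integrable_exp (hF : F (Set.Ioi 0) = 1) {y : ℝ} (hy : 0 ≤ y) :
    Integrable (fun x => Real.exp (-(x * y))) F :=
  .of_bound (by fun_prop) 1 (ae_norm_exp_le hF hy)

lemma laplace_zero : laplace F 0 = 1 := by simp [laplace]

lemma continuousOn_laplace (hF : F (Set.Ioi 0) = 1) : ContinuousOn (laplace F) (Set.Ici 0) := by
  refine continuousOn_of_dominated (bound := fun _ => 1) (fun y _ => by fun_prop)
    (fun y hy => ae_norm_exp_le hF hy) (integrable_const _) (Eventually.of_forall fun x => ?_)
  fun_prop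

lemma tendsto_laplace_atTop (hF : F (Set.Ioi 0) = 1) :
    Tendsto (laplace F) atTop (𝓝 0) := by
  have h := tendsto_integral_filter_of_dominated_convergence (μ := F) (l := atTop)
    (F := fun y x => Real.exp (-(x * y))) (f := fun _ => 0) (fun _ => 1)
    (Eventually.of_forall fun y => by fun_prop)
    ((eventually_ge_atTop 0).mono fun y hy => ae_norm_exp_le hF hy) (integrable_const _)
    (by
      filter_upwards [ae_pos hF] with x hx
      exact Real.tendsto_exp_neg_atTop_nhds_zero.comp (tendsto_id.const_mul_atTop hx))
  rw [integral_zero] at h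
  exact h

/-- Intermediate values between `φ(0) = 1` and the limit `0` at infinity. Injectivity of `φ` is
never needed: any preimage of `u` will do. -/
lemma exists_laplace_eq (hF : F (Set.Ioi 0) = 1) {u : ℝ} (hu : u ∈ Set.Ioc (0 : ℝ) 1) :
    ∃ y ∈ Set.Ici (0 : ℝ), laplace F y = u := by
  obtain ⟨b, hb, hb0⟩ := (((tendsto_laplace_atTop hF).eventually_lt_const hu.1).and
    (eventually_ge_atTop 0)).exists
  obtain ⟨y, hy, hyu⟩ := intermediate_value_Icc' hb0
    ((continuousOn_laplace hF).mono Set.Icc_subset_Ici_self)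
    (show u ∈ Set.Icc (laplace F b) (laplace F 0) from ⟨hb.le, by rw [laplace_zero]; exact hu.2⟩)
  exact ⟨y, hy.1, hyu⟩

lemma laplaceInv_nonneg (hF : F (Set.Ioi 0) = 1) {u : ℝ} (hu : u ∈ Set.Ioc (0 : ℝ) 1) :
    0 ≤ laplaceInv F u :=
  Function.invFunOn_mem (exists_laplace_eq hF hu)

lemma laplace_laplaceInv (hF : F (Set.Ioi 0) = 1) {u : ℝ} (hu : u ∈ Set.Ioc (0 : ℝ) 1) :
    laplace F (laplaceInv F u) = u :=
  Function.invFunOn_eq (exists_laplace_eq hF hu)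

lemma setIntegral_Ioi_exp (hF : F (Set.Ioi 0) = 1) (y : ℝ) :
    ∫ x in Set.Ioi 0, Real.exp (-(x * y)) ∂F = laplace F y := by
  rw [Measure.restrict_eq_self_of_ae_mem (s := Set.Ioi 0) (ae_pos hF), laplace]

lemma tilted_real (hF : F (Set.Ioi 0) = 1) {u : ℝ} (hu : u ∈ Set.Ioc (0 : ℝ) 1) {I : Set ℝ}
    (hI : I.OrdConnected) :
    (tilted F u).real I = (∫ x in I, Real.exp (-(x * laplaceInv F u)) ∂F) / u := by
  have hu0 := hu.1
  rw [Measure.real, tilted, withDensity_apply _ hI.measurableSet,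
    ← ofReal_integral_eq_lintegral_ofReal
      ((integrable_exp hF (laplaceInv_nonneg hF hu)).const_mul _).integrableOn
      (Eventually.of_forall fun x => by positivity),
    ENNReal.toReal_ofReal (integral_nonneg fun x => by positivity), integral_const_mul,
    div_eq_inv_mul]

/-- The difference of the integrands has constant sign on `(0, ∞)`, so its integral over `I` is
dominated by the full one. Replacing `φ⁻¹(u)` by `φ⁻¹(m/n)` thus costs at most `|u - m/n|`, with no
continuity of `φ⁻¹`. -/
lemma abs_setIntegral_exp_sub_le_abs_laplace_sub (hF : F (Set.Ioi 0) = 1) {s t : ℝ} (hs : 0 ≤ s)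
    (ht : 0 ≤ t) (I : Set ℝ) :
    |∫ x in I, Real.exp (-(x * s)) ∂F - ∫ x in I, Real.exp (-(x * t)) ∂F| ≤
      |laplace F s - laplace F t| := by
  wlog hst : s ≤ t generalizing s t
  · rw [abs_sub_comm, abs_sub_comm (laplace F s)]
    exact this ht hs (le_of_not_ge hst)
  have h1 := integrable_exp hF hs
  have h2 := integrable_exp hF ht
  have hnn : 0 ≤ᵐ[F] fun x => Real.exp (-(x * s)) - Real.exp (-(x * t)) := by
    filter_upwards [ae_pos hF] with x hx
    exact sub_nonneg.2 (Real.exp_le_exp.2 (neg_le_neg (mul_le_mul_of_nonneg_left hst hx.le)))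
  rw [laplace, laplace, ← integral_sub h1.integrableOn h2.integrableOn, ← integral_sub h1 h2,
    abs_of_nonneg (setIntegral_nonneg_of_ae hnn), abs_of_nonneg (integral_nonneg_of_ae hnn)]
  exact setIntegral_le_integral (h1.sub h2) hnn

/-- The empirical distribution of the numbers `x i`, as a measure. -/
noncomputable def empiricalMeasure {n : ℕ} (x : Fin n → ℝ) : Measure ℝ :=
  (n : ℝ≥0∞)⁻¹ • ∑ i, Measure.dirac (x i)

lemma isProbabilityMeasure_empiricalMeasure {n : ℕ} (hn : 0 < n) (x : Fin n → ℝ) :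
    IsProbabilityMeasure (empiricalMeasure x) :=
  ⟨by simp [empiricalMeasure, ENNReal.inv_mul_cancel (Nat.cast_ne_zero.2 hn.ne')]⟩

open Classical in
lemma setIntegral_empiricalMeasure {n : ℕ} (x : Fin n → ℝ) {f : ℝ → ℝ} {I : Set ℝ}
    (hI : MeasurableSet I) :
    ∫ s in I, f s ∂empiricalMeasure x = (∑ i ∈ Finset.univ.filter (x · ∈ I), f (x i)) / n := by
  rw [empiricalMeasure, ← integral_indicator hI, integral_smul_measure,
    integral_finsetSum_measure fun i _ => integrable_dirac (by finiteness)]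
  simp [Finset.sum_filter, Set.indicator_apply, div_eq_inv_mul]

lemma empiricalMeasure_real {n : ℕ} (x : Fin n → ℝ) {I : Set ℝ} (hI : MeasurableSet I) :
    (empiricalMeasure x).real I = empirical Finset.univ x I := by
  classical
  have h := setIntegral_empiricalMeasure x (f := fun _ => 1) hI
  simp only [integral_const, smul_eq_mul, mul_one, measureReal_restrict_apply_univ] at h
  rw [h, empirical]
  simp [Set.indicator_apply]

end

/-! ### Deterministic comparison of the last terms with the survivors. -/

lemma card_lastPositions {n m : ℕ} (h : m ≤ n) : (lastPositions n m).card = m := by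
  have h1 : (lastPositions n m).map Fin.valEmbedding = Finset.Ico (n - m) n := by
    ext k
    simp only [lastPositions, Finset.mem_map, Finset.mem_filter, Finset.mem_univ, true_and,
      Fin.valEmbedding_apply, Finset.mem_Ico]
    constructor
    · rintro ⟨j, hj, rfl⟩
      have := j.2
      omega
    · exact fun hk => ⟨⟨k, hk.2⟩, by simp only; omega, rfl⟩
  rw [← Finset.card_map Fin.valEmbedding, h1, Nat.card_Ico]
  omega

open Classical in
lemma empirical_eq {ι : Type*} (s : Finset ι) (y : ι → ℝ) (I : Set ℝ) :
    empirical s y I = ((s.filter (y · ∈ I)).card : ℝ) / s.card := by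
  simp [empirical, Set.indicator_apply]

lemma abs_card_filter_sub_le_of_subset {ι : Type*} {A L : Finset ι} (h : L ⊆ A) (p : ι → Prop)
    [DecidablePred p] :
    |((L.filter p).card : ℝ) - (A.filter p).card| ≤ |(L.card : ℝ) - A.card| := by
  classical
  have h1 := Finset.card_sdiff_add_card_eq_card (Finset.filter_subset_filter p h)
  have h2 := Finset.card_sdiff_add_card_eq_card h
  have h3 : (A.filter p \ L.filter p).card ≤ (A \ L).card :=
    Finset.card_le_card fun i hi => by simp at hi ⊢; tauto
  rw [← h1, ← h2]
  push_cast
  have h3' : ((A.filter p \ L.filter p).card : ℝ) ≤ (A \ L).card := by exact_mod_cast h3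
  simpa using h3'

/-- The last `m` positions and the positions of the times after `s` are nested, so that the counts
in these two sets of positions differ by at most the difference of their sizes. -/
lemma abs_card_filter_lastPositions_sub_le {n : ℕ} (m : ℕ) {ζ : Fin n → ℝ} (hζ : StrictMono ζ)
    (s : ℝ) (p : Fin n → Prop) [DecidablePred p] :
    |(((lastPositions n m).filter p).card : ℝ) -
        ((Finset.univ.filter (s < ζ ·)).filter p).card| ≤
      |((lastPositions n m).card : ℝ) - (Finset.univ.filter (s < ζ ·)).card| := by
  by_cases h : lastPositions n m ⊆ Finset.univ.filter (s < ζ ·)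
  · exact abs_card_filter_sub_le_of_subset h p
  · rw [abs_sub_comm, abs_sub_comm ((lastPositions n m).card : ℝ)]
    refine abs_card_filter_sub_le_of_subset (fun k hk => ?_) p
    -- If a last position `j` has time at most `s`, every survivor comes after `j`, hence is among
    -- the last positions.
    obtain ⟨j, hj, hj'⟩ := Finset.not_subset.1 h
    simp only [lastPositions, Finset.mem_filter, Finset.mem_univ, true_and, not_lt] at hj hj' hk ⊢
    have : j < k := hζ.lt_iff_lt.1 (hj'.trans_lt hk)
    have := Fin.lt_def.1 this
    omega

open Classical in
lemma deviation_eq {n : ℕ} (x : Fin n → ℝ) (π : Equiv.Perm (Fin n)) (ξ : Fin n → ℝ) (s : ℝ)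
    (I : Set ℝ) :
    deviation x (Finset.univ.filter (x · ∈ I)) s ξ =
      ((Finset.univ.filter fun k => s < ξ (π k)).filter fun k => x (π k) ∈ I).card -
        ∑ i ∈ Finset.univ.filter (x · ∈ I), Real.exp (-(x i * s)) := by
  rw [deviation, Finset.sum_sub_distrib, Finset.filter_filter]
  congr 1
  have : (Finset.univ.filter fun k => s < ξ (π k) ∧ x (π k) ∈ I).card =
      (Finset.univ.filter fun i => s < ξ i ∧ x i ∈ I).card :=
    Finset.card_equiv π fun k => by simp
  rw [this]
  simp [Set.indicator_apply, Finset.filter_filter, and_comm]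

section

variable {F : Measure ℝ} [IsProbabilityMeasure F]

open Classical in
lemma abs_sum_exp_div_sub_le {n : ℕ} (hn : 0 < n) (x : Fin n → ℝ)
    {D : ℝ} (hD : ∀ t, |empirical Finset.univ x (Set.Iic t) - cdf F t| ≤ D) {y : ℝ} (hy : 0 ≤ y)
    {I : Set ℝ} (hI : I.OrdConnected) (hI0 : I ⊆ Set.Ioi 0) :
    |(∑ i ∈ Finset.univ.filter (x · ∈ I), Real.exp (-(x i * y))) / n -
      ∫ x in I, Real.exp (-(x * y)) ∂F| ≤ 2 * D := by
  have := isProbabilityMeasure_empiricalMeasure hn x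
  rw [← setIntegral_empiricalMeasure x (f := fun s => Real.exp (-(s * y))) hI.measurableSet]
  refine abs_setIntegral_exp_sub_le (fun t => ?_) hy hI hI0
  rw [empiricalMeasure_real x measurableSet_Iic, ← cdf_eq_real]
  exact hD t

lemma abs_div_sub_div_le {a b p u δ e f : ℝ} (hδ : 0 < δ) (hu : δ ≤ u) (hp : 0 < p) (ha : 0 ≤ a)
    (hap : a ≤ p) (hab : |a - b| ≤ e) (hpu : |u - p| ≤ f) : |a / p - b / u| ≤ (e + f) / δ := by
  have hu0 : 0 < u := hδ.trans_le hu
  have h1 : a / p - b / u = (a / p * (u - p) + (a - b)) / u := by field_simp; ring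
  have hq : |a / p| ≤ 1 := by
    rw [abs_of_nonneg (by positivity)]
    exact (div_le_one hp).2 hap
  have h2 : |a / p * (u - p) + (a - b)| ≤ e + f := by
    refine (abs_add_le _ _).trans ?_
    rw [abs_mul]
    nlinarith [abs_nonneg (u - p), abs_nonneg (a / p)]
  rw [h1, abs_div, abs_of_pos hu0]
  exact div_le_div₀ ((abs_nonneg _).trans h2) h2 hδ hu

open Classical in
/-- If the times `ξ` sorted by `π` have small deviations at the times `φ⁻¹ (m / n)`, then the last
terms of `x ∘ π` are distributed nearly as the tilted distributions. -/
lemma abs_empirical_sub_tilted_le (hF : F (Set.Ioi 0) = 1) {n : ℕ} {x : Fin n → ℝ}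
    (hx : ∀ i, 0 < x i) {D : ℝ}
    (hD : ∀ t, |empirical Finset.univ x (Set.Iic t) - cdf F t| ≤ D)
    {π : Equiv.Perm (Fin n)} {ξ : Fin n → ℝ} (hξ : StrictMono (ξ ∘ π)) {η : ℝ}
    (hdev : ∀ m ∈ Finset.Icc 1 n, ∀ I : Set ℝ, I.OrdConnected →
      |deviation x (Finset.univ.filter (x · ∈ I)) (laplaceInv F ((m : ℝ) / n)) ξ| ≤ n * η)
    {δ : ℝ} (hδ : 0 < δ) (hnδ : 1 ≤ n * δ) {u : ℝ} (hu : u ∈ Set.Icc δ 1) {I : Set ℝ}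
    (hI : I.OrdConnected) (hI0 : I ⊆ Set.Ioi 0) :
    |empirical (lastPositions n ⌊(n : ℝ) * u⌋₊) (fun j => x (π j)) I - (tilted F u).real I| ≤
      (2 * η + 4 * D + 2 / n) / δ := by
  have hn : 0 < n := by
    rcases Nat.eq_zero_or_pos n with rfl | h
    · norm_num at hnδ
    · exact h
  have hn' : (0 : ℝ) < n := by exact_mod_cast hn
  have hu0 : 0 < u := hδ.trans_le hu.1
  set m := ⌊(n : ℝ) * u⌋₊ with hm
  have hm1 : 1 ≤ m := Nat.le_floor (by
    push_cast
    exact hnδ.trans (mul_le_mul_of_nonneg_left hu.1 hn'.le))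
  have hmu : (m : ℝ) ≤ n * u := Nat.floor_le (by positivity)
  have hum : (n : ℝ) * u < m + 1 := Nat.lt_floor_add_one _
  have hmn : m ≤ n := by
    have : (m : ℝ) ≤ n := hmu.trans (by nlinarith [hu.2])
    exact_mod_cast this
  have hm' : (0 : ℝ) < m := by exact_mod_cast hm1
  have hp : (m : ℝ) / n ∈ Set.Ioc (0 : ℝ) 1 :=
    ⟨by positivity, (div_le_one hn').2 (by exact_mod_cast hmn)⟩
  have huI : u ∈ Set.Ioc (0 : ℝ) 1 := ⟨hu0, hu.2⟩
  have hpu : |u - (m : ℝ) / n| ≤ 1 / n := by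
    have h1 : u - (m : ℝ) / n = (n * u - m) / n := by field_simp
    rw [h1, abs_div, abs_of_pos hn', abs_of_nonneg (by linarith)]
    gcongr
    linarith
  set s := laplaceInv F ((m : ℝ) / n) with hs
  have hs0 : 0 ≤ s := laplaceInv_nonneg hF hp
  set N : Set ℝ → ℝ := fun J =>
    ((Finset.univ.filter fun k => s < ξ (π k)).filter fun k => x (π k) ∈ J).card with hN
  have hNG : ∀ J : Set ℝ, J.OrdConnected → J ⊆ Set.Ioi 0 →
      |N J / n - ∫ x in J, Real.exp (-(x * s)) ∂F| ≤ η + 2 * D := by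
    intro J hJ hJ0
    have h1 := hdev m (Finset.mem_Icc.2 ⟨hm1, hmn⟩) J hJ
    rw [deviation_eq x π ξ s J] at h1
    have h2 := abs_sum_exp_div_sub_le hn x hD hs0 hJ hJ0
    have h3 : |(N J - ∑ i ∈ Finset.univ.filter (x · ∈ J), Real.exp (-(x i * s))) / n| ≤ η := by
      rw [abs_div, abs_of_pos hn', div_le_iff₀ hn', mul_comm η]
      exact h1
    rw [sub_div] at h3
    exact (abs_sub_le _ _ _).trans (add_le_add h3 h2)
  have hcard := abs_card_filter_lastPositions_sub_le m (ζ := fun k => ξ (π k)) hξ s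
    (fun k => x (π k) ∈ I)
  have hall : N (Set.Ioi 0) = (Finset.univ.filter fun k => s < ξ (π k)).card := by
    refine congrArg (fun A : Finset (Fin n) => (A.card : ℝ)) (Finset.ext fun k => ?_)
    simp [hx (π k)]
  rw [card_lastPositions hmn, ← hall] at hcard
  -- With `J = (0, ∞)` this says that the number of survivors is `m` up to `n (η + 2D)`.
  have h1 := hNG (Set.Ioi 0) Set.ordConnected_Ioi subset_rfl
  rw [setIntegral_Ioi_exp hF, laplace_laplaceInv hF hp] at h1
  have h2 := hNG I hI hI0
  have h3 := abs_setIntegral_exp_sub_le_abs_laplace_sub hF hs0 (laplaceInv_nonneg hF huI) I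
  rw [laplace_laplaceInv hF hp, laplace_laplaceInv hF huI, abs_sub_comm _ u] at h3
  set c : ℝ := (((lastPositions n m).filter fun k => x (π k) ∈ I).card : ℝ) with hc
  have hcm : c ≤ m := by
    have := Finset.card_filter_le (lastPositions n m) fun k => x (π k) ∈ I
    rw [card_lastPositions hmn] at this
    rw [hc]
    exact_mod_cast this
  -- By nestedness, the error inside `I` is at most the error in the total count.
  have h4 : |c / n - N I / n| ≤ η + 2 * D := by
    rw [← sub_div, abs_div, abs_of_pos hn']
    refine le_trans ?_ h1
    rw [← sub_div, abs_div, abs_of_pos hn', abs_sub_comm (N (Set.Ioi 0))]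
    gcongr
  have h5 : |c / n - ∫ x in I, Real.exp (-(x * laplaceInv F u)) ∂F| ≤
      2 * η + 4 * D + 1 / n := by
    have := (abs_sub_le (c / n) (N I / n) (∫ x in I, Real.exp (-(x * laplaceInv F u)) ∂F)).trans
      (add_le_add h4 ((abs_sub_le _ _ _).trans (add_le_add h2 (h3.trans hpu))))
    linarith
  have h6 := abs_div_sub_div_le hδ hu.1 hp.1 (by positivity) (by gcongr) h5 hpu
  rw [empirical_eq, card_lastPositions hmn, tilted_real hF huI hI]
  convert h6 using 2
  · congr 1
    field_simp
    exact hc.symm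
  · ring

end

/-! ### Summable error probabilities and Borel–Cantelli. -/

lemma summable_cube_mul_exp_neg_sqrt :
    Summable fun n : ℕ => 2 * (n : ℝ) ^ 3 * Real.exp (-(2 * √(n : ℝ))) := by
  have h2 := (Real.summable_one_div_nat_pow.2 one_lt_two).mul_left ((Nat.factorial 10 : ℝ) / 512)
  refine Summable.of_nonneg_of_le (fun n => by positivity) (fun n => ?_) h2
  rcases Nat.eq_zero_or_pos n with rfl | hn
  · simp
  have hn' : (0 : ℝ) < n := by exact_mod_cast hn
  -- The power 10 turns `√n` into `n⁵`, which beats `n³` by the summable `n⁻²`.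
  have h3 := Real.pow_div_factorial_le_exp (2 * √(n : ℝ)) (by positivity) 10
  have h4 : (2 * √(n : ℝ)) ^ 10 = 1024 * (n : ℝ) ^ 5 := by
    calc (2 * √(n : ℝ)) ^ 10 = 1024 * (√(n : ℝ) ^ 2) ^ 5 := by ring
      _ = _ := by rw [Real.sq_sqrt hn'.le]
  rw [h4] at h3
  have hf : (0 : ℝ) < Nat.factorial 10 := by exact_mod_cast Nat.factorial_pos 10
  rw [Real.exp_neg]
  calc 2 * (n : ℝ) ^ 3 * (Real.exp (2 * √(n : ℝ)))⁻¹
      ≤ 2 * (n : ℝ) ^ 3 * (1024 * (n : ℝ) ^ 5 / Nat.factorial 10)⁻¹ := by gcongr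
    _ = (Nat.factorial 10 : ℝ) / 512 * (1 / (n : ℝ) ^ 2) := by
      generalize (Nat.factorial 10 : ℝ) = c at hf ⊢
      field_simp
      norm_num

lemma empirical_mem_Icc {ι : Type*} (s : Finset ι) (y : ι → ℝ) (A : Set ℝ) :
    empirical s y A ∈ Set.Icc (0 : ℝ) 1 := by
  classical
  rw [empirical_eq]
  refine ⟨by positivity, div_le_one_of_le₀ ?_ (by positivity)⟩
  exact_mod_cast Finset.card_filter_le _ _

lemma abs_empirical_sub_cdf_le (F : Measure ℝ) {n : ℕ} (x : Fin n → ℝ) (t : ℝ) :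
    |empirical Finset.univ x (Set.Iic t) - cdf F t| ≤
      (⨆ t : ℝ, ‖empirical Finset.univ x (Set.Iic t) - cdf F t‖ₑ).toReal := by
  -- The supremum must be finite, since `toReal` sends `∞` to `0`.
  have hb : ∀ t, ‖empirical Finset.univ x (Set.Iic t) - cdf F t‖ₑ ≤ ENNReal.ofReal 1 := by
    intro t
    rw [← ofReal_norm]
    refine ENNReal.ofReal_le_ofReal ?_
    have h1 := empirical_mem_Icc Finset.univ x (Set.Iic t)
    rw [Real.norm_eq_abs, abs_le]
    constructor <;> linarith [h1.1, h1.2, cdf_nonneg F t, cdf_le_one F t]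
  rw [← Real.norm_eq_abs, ← toReal_enorm]
  exact ENNReal.toReal_mono (ne_top_of_le_ne_top ENNReal.ofReal_ne_top (iSup_le hb))
    (le_iSup (fun t => ‖empirical Finset.univ x (Set.Iic t) - cdf F t‖ₑ) t)

open Classical in
/-- The probability that the last terms of a size-biased permutation are not distributed nearly as
the tilted distributions. -/
lemma IsSizeBiasedPerm.measure_not_abs_empirical_sub_tilted_le {F : Measure ℝ}
    [IsProbabilityMeasure F] (hF : F (Set.Ioi 0) = 1) {n : ℕ} {x : Fin n → ℝ}
    (hx : ∀ i, 0 < x i) {D : ℝ}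
    (hD : ∀ t, |empirical Finset.univ x (Set.Iic t) - cdf F t| ≤ D)
    {Ω : Type*} [MeasurableSpace Ω] {P : Measure Ω} [IsProbabilityMeasure P]
    {σ : Ω → Equiv.Perm (Fin n)} (hσ : IsSizeBiasedPerm P x σ) {η : ℝ} (hη : 0 < η)
    {δ : ℝ} (hδ : 0 < δ) :
    P {ω | 1 ≤ n * δ ∧ ¬ ∀ u ∈ Set.Icc δ 1, ∀ I : Set ℝ, I.OrdConnected → I ⊆ Set.Ioi 0 →
      |empirical (lastPositions n ⌊(n : ℝ) * u⌋₊) (fun j => x (σ ω j)) I - (tilted F u).real I| ≤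
      (2 * η + 4 * D + 2 / n) / δ} ≤
      ENNReal.ofReal (2 * n ^ 3 * Real.exp (-(2 * n * η ^ 2))) := by
  have hp : ∀ i, IsProbabilityMeasure (expMeasure (x i)) := fun i =>
    isProbabilityMeasure_expMeasure (hx i)
  refine (hσ.measure_le hx {π | 1 ≤ n * δ ∧ ¬ ∀ u ∈ Set.Icc δ 1, ∀ I : Set ℝ,
    I.OrdConnected → I ⊆ Set.Ioi 0 → |empirical (lastPositions n ⌊(n : ℝ) * u⌋₊)
      (fun j => x (π j)) I - (tilted F u).real I| ≤ (2 * η + 4 * D + 2 / n) / δ}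
    {ξ | ∃ m ∈ Finset.Icc 1 n, ∃ I : Set ℝ, I.OrdConnected ∧ (n : ℝ) * η ≤
      |deviation x (Finset.univ.filter (x · ∈ I)) (laplaceInv F ((m : ℝ) / n)) ξ|} ?_).trans ?_
  · rintro π ⟨hnδ, hπ⟩ ξ hξ
    by_contra hcon
    refine hπ fun u hu I hI hI0 => abs_empirical_sub_tilted_le hF hx hD hξ
      (fun m hm J hJ => ?_) hδ hnδ hu hI hI0
    by_contra! hlt
    exact hcon ⟨m, hm, J, hJ, hlt.le⟩
  · rw [← ENNReal.ofReal_toReal (measure_ne_top (Measure.pi _) _)]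
    refine ENNReal.ofReal_le_ofReal (measureReal_exists_le_abs_deviation hx
      (t := fun m => laplaceInv F ((m : ℝ) / n)) (fun m hm => laplaceInv_nonneg hF ?_) hη)
    obtain ⟨h1, h2⟩ := Finset.mem_Icc.1 hm
    have hn : (0 : ℝ) < n := by exact_mod_cast h1.trans h2
    exact ⟨div_pos (by exact_mod_cast h1) hn, (div_le_one hn).2 (by exact_mod_cast h2)⟩

end SizeBiased

theorem mainTheorem5
    (x : (n : ℕ) → Fin n → ℝ) (hx : ∀ n i, 0 < x n i)
    (F : Measure ℝ) [IsProbabilityMeasure F] (hF : F (Set.Ioi 0) = 1)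
    (hE : Tendsto
      (fun n : ℕ => ⨆ t : ℝ, ‖SizeBiased.empirical Finset.univ (x n) (Set.Iic t) - cdf F t‖ₑ)
      atTop (𝓝 0))
    {Ω : Type*} [MeasurableSpace Ω] (P : Measure Ω) [IsProbabilityMeasure P]
    (σ : (n : ℕ) → Ω → Equiv.Perm (Fin n))
    (hσ : ∀ n, SizeBiased.IsSizeBiasedPerm P (x n) (σ n))
    (δ : ℝ) (hδ : δ ∈ Set.Ioo (0 : ℝ) 1) :
    ∀ᵐ ω ∂P, Tendsto
      (fun n : ℕ => ⨆ u ∈ Set.Icc δ 1, ⨆ I ∈ {I : Set ℝ | I.OrdConnected ∧ I ⊆ Set.Ioi 0},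
        ‖SizeBiased.empirical (SizeBiased.lastPositions n ⌊(n : ℝ) * u⌋₊)
            (fun j => x n (σ n ω j)) I
          - (SizeBiased.tilted F u).real I‖ₑ)
      atTop (𝓝 0) := by
  let D : ℕ → ℝ := fun n =>
    (⨆ t : ℝ, ‖SizeBiased.empirical Finset.univ (x n) (Set.Iic t) - cdf F t‖ₑ).toReal
  -- The choice `η = n^(-1/4)` tends to 0 while `2nη² = 2√n` keeps the tails summable.
  let η : ℕ → ℝ := fun n => (√√((n : ℝ)))⁻¹
  have hD : Tendsto D atTop (𝓝 0) := by
    exact (ENNReal.tendsto_toReal ENNReal.zero_ne_top).comp hE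
  have hη : Tendsto η atTop (𝓝 0) :=
    (Real.tendsto_sqrt_atTop.comp
      (Real.tendsto_sqrt_atTop.comp tendsto_natCast_atTop_atTop)).inv_tendsto_atTop
  have hb : Tendsto (fun n : ℕ => ENNReal.ofReal ((2 * η n + 4 * D n + 2 / (n : ℝ)) / δ)) atTop
      (𝓝 0) := by
    have h := ((((hη.const_mul 2).add (hD.const_mul 4)).add
      (tendsto_const_div_atTop_nhds_zero_nat 2)).div_const δ)
    simpa using ENNReal.tendsto_ofReal h
  have hbad : ∀ n : ℕ, P {ω | 1 ≤ n * δ ∧ ¬ ∀ u ∈ Set.Icc δ 1, ∀ I : Set ℝ,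
      I.OrdConnected → I ⊆ Set.Ioi 0 →
      |SizeBiased.empirical (SizeBiased.lastPositions n ⌊(n : ℝ) * u⌋₊)
        (fun j => x n (σ n ω j)) I - (SizeBiased.tilted F u).real I| ≤
      (2 * η n + 4 * D n + 2 / n) / δ} ≤
      ENNReal.ofReal (2 * (n : ℝ) ^ 3 * Real.exp (-(2 * √(n : ℝ)))) := by
    intro n
    rcases Nat.eq_zero_or_pos n with rfl | hn
    -- For `n = 0` the requirement `1 ≤ n * δ` fails, so the event is empty.
    · norm_num
    have hn' : (0 : ℝ) < n := by exact_mod_cast hn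
    have h := (hσ n).measure_not_abs_empirical_sub_tilted_le hF (hx n)
      (SizeBiased.abs_empirical_sub_cdf_le F (x n)) (η := η n) (by positivity) hδ.1
    have h2 : 2 * (n : ℝ) * η n ^ 2 = 2 * √(n : ℝ) := by
      simp only [η]
      rw [inv_pow, Real.sq_sqrt (Real.sqrt_nonneg _), mul_assoc, ← div_eq_mul_inv, Real.div_sqrt]
    rwa [h2] at h
  -- The first Borel–Cantelli lemma needs no independence, so the joint law of the `σ n` is
  -- irrelevant.
  have hsum := ne_top_of_le_ne_top
    (SizeBiased.summable_cube_mul_exp_neg_sqrt.tsum_ofReal_ne_top) (ENNReal.tsum_le_tsum hbad)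
  filter_upwards [ae_eventually_notMem hsum] with ω hω
  refine tendsto_of_tendsto_of_tendsto_of_le_of_le' tendsto_const_nhds hb
    (Eventually.of_forall fun _ => zero_le) ?_
  filter_upwards [hω, (tendsto_natCast_atTop_atTop.atTop_mul_const hδ.1).eventually_ge_atTop 1]
    with n hn hnδ
  have hgood := not_not.1 fun hcon => hn ⟨hnδ, hcon⟩
  refine iSup₂_le fun u hu => iSup₂_le fun I hI => ?_
  rw [← ofReal_norm]
  exact ENNReal.ofReal_le_ofReal (hgood u hu I hI.1 hI.2)
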